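/- Let $X_1, X_2$ be independent real random variables with a common distribution $F_X$, let $n\in\{1,2\}$, and let $Z$ be a random variable whose conditional distribution given $X_1=x_1$, $X_2=x_2$ is the directed power distribution with exponent $n$, i.e. has distribution function $$F(z\mid x_1,x_2)=\begin{cases}1,& z\ge \max(x_1,x_2),\\ \left(\frac{z-x_1}{x_2-x_1}\right)^n,& x_1<z<x_2,\\ 1-\left(\frac{z-x_1}{x_2-x_1}\right)^n,& x_2<z<x_1,\\ 0,&\text{otherwise}\end{cases}$$ (the point mass at the common value if $x_1=x_2$). Write $F_Z$ for the distribution of $Z$ and $\mathcal S(H,z)=\int_{\mathbb R}\frac{1}{z-x}\,H(dx)$ for the Stieltjes transform of a distribution $H$, $z\in\mathbb C\setminus\operatorname{supp}H$. Then the characterizations of $Z$ for $n=1$ (uniform between $X_1$ and $X_2$) and for $n=2$ (directed triangular) are identical, in the following sense: 1. For both values of $n$, $\mathcal S(F_Z,\cdot)$ is differentiable and $-\mathcal S'(F_Z,z)=\mathcal S(F_X,z)^2$ at every $z\in\mathbb C$ outside $\operatorname{supp}F_X\cup\operatorname{supp}F_Z$. 2. The distribution of $Z$ depends only on $F_X$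 and not on which $n\in\{1,2\}$ is taken: it is the same for $n=1$ and $n=2$. 3. For both values of $n$, $Z$ is uniformly distributed on $[-1,1]$ if and only if $F_X$ is the arcsine distribution on $[-1,1]$, with density $\frac{1}{\pi\sqrt{1-x^2}}$ on $(-1,1)$. 4. For both values of $n$, $Z$ has distribution $F_X$ if and only if $F_X$ is degenerate (a point mass) or a Cauchy distribution (with some location $c\in\mathbb R$ and scale $\gamma>0$). -/

import Mathlib

open MeasureTheory ProbabilityTheory

noncomputable section

/-- The distribution function `z ↦ F(z | x₁, x₂)` of the directed power distribution with
exponent `n` between `x₁` and `x₂`. The clauses are tried in order, so that for `x₁ = x₂` it is the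
distribution function of the point mass at the common value. -/
def directedPowerCDF (n : ℕ) (x₁ x₂ z : ℝ) : ℝ :=
  open Classical in
  if max x₁ x₂ ≤ z then 1
  else if x₁ < z ∧ z < x₂ then ((z - x₁) / (x₂ - x₁)) ^ n
  else if x₂ < z ∧ z < x₁ then 1 - ((z - x₁) / (x₂ - x₁)) ^ n
  else 0

/-- `X₁` and `X₂` are independent random variables on `(Ω, P)` with common distribution `μ`, and the
conditional distribution of `Z` given `X₁ = x₁`, `X₂ = x₂` is the directed power distribution
with exponent `n` between `x₁` and `x₂`. -/
structure IsDirectedPower {Ω : Type*} [MeasurableSpace Ω] (P : Measure Ω) [IsProbabilityMeasure P]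
    (n : ℕ) (μ : Measure ℝ) (X₁ X₂ Z : Ω → ℝ) : Prop where
  measurable_fst : Measurable X₁
  measurable_snd : Measurable X₂
  measurable_between : Measurable Z
  indep : IndepFun X₁ X₂ P
  law_fst : P.map X₁ = μ
  law_snd : P.map X₂ = μ
  cond_law : ∀ᵐ x ∂(P.map fun ω => (X₁ ω, X₂ ω)), ∀ z : ℝ,
    cdf (condDistrib Z (fun ω => (X₁ ω, X₂ ω)) P x) z = directedPowerCDF n x.1 x.2 z

/-- The Stieltjes transform `S(ν, z) = ∫ 1 / (z - x) ν(dx)`; it is only used for `z` outside the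
support of `ν`, where the integrand is bounded `ν`-almost everywhere. -/
def stieltjesTransform (ν : Measure ℝ) (z : ℂ) : ℂ :=
  ∫ x : ℝ, 1 / (z - (x : ℂ)) ∂ν

/-- The arcsine distribution on `[-1, 1]`. -/
def arcsineMeasure : Measure ℝ :=
  (volume.restrict (Set.Ioo (-1) 1)).withDensity
    fun x => ENNReal.ofReal (1 / (Real.pi * Real.sqrt (1 - x ^ 2)))

end

/-!
The conditional distribution function of `Z` for the exponent two, averaged over the exchange of
`x₁` and `x₂`, is the one for the exponent one (`directedPowerCDF_two_add_swap`). As `X₁` and `X₂`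
are exchangeable, both exponents give `Z` the law `segmentLaw μ` of a uniformly chosen point of the
segment from `X₁` to `X₂` (`IsDirectedPower.map_eq_segmentLaw`).

For non-real `z`, averaging `1 / (z - Z)²` over that point gives `1 / ((z - X₁) (z - X₂))`, whose
expectation is `S(μ, z)²` by independence; this is the equation `-S'(F_Z, z) = S(μ, z)²`. At real
points outside the supports it follows by continuity
(`hasDerivAt_stieltjesTransform_segmentLaw`).

Both characterizations are read off from this equation on the upper half-plane, where `S(ν, ·)`
determines `ν` (`eq_of_stieltjesTransform_eq`, by smoothing with Cauchy distributions), and even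
`S'(ν, ·)` does, since `S(ν, iy) → 0` as `y → ∞` (`eq_of_hasDerivAt_stieltjesTransform`).

* For the uniform law on `[-1, 1]` the left side is `1 / (z² - 1)`, which is also the square of the
  arcsine transform (`stieltjesTransform_arcsineMeasure_sq`); the sign of the square root is forced
  by `Im S(ν, z) < 0`.
* If `Z` has law `μ`, then `-S' = S²`, that is `(1 / S)' = 1`, so `S(μ, z) = 1 / (z - a)` with
  `Im a ≤ 0`. These are the transforms of the point masses and the Cauchy distributions
  (`stieltjesTransform_cauchyMeasure`).

The arcsine and Cauchy transforms are computed without contour integration: an integration by parts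
yields a first-order linear differential equation in `z`, which is then solved.
-/

section

open Filter Topology Complex

/-! ### The Stieltjes transform of a finite measure -/

lemma stieltjesTransform_eq_neg_resolventTransform (ν : Measure ℝ) :
    stieltjesTransform ν = -resolventTransform ν := by
  ext z
  simp only [stieltjesTransform, resolventTransform_apply, Pi.neg_apply, ← integral_neg]
  congr with x
  rw [resolvent, Ring.inverse_eq_inv', ← neg_sub z, inv_neg, neg_neg, one_div]
  rfl

lemma notMem_image_support {ν : Measure ℝ} {z : ℂ} (hz : ∀ x ∈ ν.support, (x : ℂ) ≠ z) :
    z ∉ algebraMap ℝ ℂ '' ν.support := by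
  rintro ⟨x, hx, rfl⟩
  exact hz x hx rfl

lemma ofReal_ne_of_im_ne_zero {z : ℂ} (hz : z.im ≠ 0) (x : ℝ) : (x : ℂ) ≠ z := by
  rintro rfl
  simp at hz

lemma sub_ofReal_ne_zero {z : ℂ} (hz : z.im ≠ 0) (x : ℝ) : z - x ≠ 0 :=
  sub_ne_zero.mpr (ofReal_ne_of_im_ne_zero hz x).symm

lemma hasDerivAt_stieltjesTransform {ν : Measure ℝ} [IsFiniteMeasure ν] {z : ℂ}
    (hz : ∀ x ∈ ν.support, (x : ℂ) ≠ z) :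
    HasDerivAt (stieltjesTransform ν) (-∫ x : ℝ, 1 / (z - x) ^ 2 ∂ν) z := by
  rw [stieltjesTransform_eq_neg_resolventTransform]
  refine (hasDerivAt_resolventTransform z (notMem_image_support hz)).neg.congr_deriv ?_
  congr with x
  rw [resolvent, Ring.inverse_eq_inv', ← neg_sub z, inv_neg, neg_sq, one_div, inv_pow]
  rfl

lemma isOpen_compl_image_support (ν : Measure ℝ) :
    IsOpen {z : ℂ | ∀ x ∈ ν.support, (x : ℂ) ≠ z} := by
  have : {z : ℂ | ∀ x ∈ ν.support, (x : ℂ) ≠ z} = (((↑) : ℝ → ℂ) '' ν.support)ᶜ := by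
    ext z
    simp
  rw [this]
  exact (isometry_ofReal.isClosedEmbedding.isClosedMap _ Measure.isClosed_support).isOpen_compl

lemma norm_one_div_sub_ofReal_le {z : ℂ} (hz : z.im ≠ 0) (x : ℝ) :
    ‖1 / (z - x)‖ ≤ 1 / |z.im| := by
  rw [norm_div, norm_one]
  gcongr
  simpa using abs_im_le_norm (z - x)

lemma integrable_one_div_sub (ν : Measure ℝ) [IsFiniteMeasure ν] {z : ℂ} (hz : z.im ≠ 0) :
    Integrable (fun x : ℝ ↦ 1 / (z - x)) ν := by
  refine Integrable.of_bound (by measurability) (1 / |z.im|) (ae_of_all _ fun x ↦ ?_)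
  exact norm_one_div_sub_ofReal_le hz x

lemma integrable_one_div_sub_sq (ν : Measure ℝ) [IsFiniteMeasure ν] {z : ℂ} (hz : z.im ≠ 0) :
    Integrable (fun x : ℝ ↦ 1 / (z - x) ^ 2) ν := by
  refine Integrable.of_bound (by measurability) ((1 / |z.im|) ^ 2) (ae_of_all _ fun x ↦ ?_)
  rw [← one_div_pow, norm_pow]
  exact pow_le_pow_left₀ (norm_nonneg _) (norm_one_div_sub_ofReal_le hz x) 2

lemma im_one_div_sub_ofReal (z : ℂ) (x : ℝ) :
    (1 / (z - x)).im = -(z.im * ((z.re - x) ^ 2 + z.im ^ 2)⁻¹) := by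
  rw [one_div, inv_im, normSq_apply]
  simp only [sub_im, ofReal_im, sub_zero, sub_re, ofReal_re]
  rw [neg_div, div_eq_mul_inv, sq, sq]

/-- The imaginary part of the Stieltjes transform at height `y` is `-π` times the density of the
convolution with the Cauchy distribution of scale `y`. -/
lemma im_stieltjesTransform (ν : Measure ℝ) [IsFiniteMeasure ν] {z : ℂ} (hz : z.im ≠ 0) :
    (stieltjesTransform ν z).im = -∫ x, z.im * ((z.re - x) ^ 2 + z.im ^ 2)⁻¹ ∂ν := by
  have h : (∫ x : ℝ, 1 / (z - x) ∂ν).im = ∫ x : ℝ, (1 / (z - x)).im ∂ν :=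
    (integral_im (𝕜 := ℂ) (integrable_one_div_sub ν hz)).symm
  rw [stieltjesTransform, h, ← integral_neg]
  exact integral_congr_ae (ae_of_all _ (im_one_div_sub_ofReal z))

lemma im_stieltjesTransform_neg (ν : Measure ℝ) [IsProbabilityMeasure ν] {z : ℂ} (hz : 0 < z.im) :
    (stieltjesTransform ν z).im < 0 := by
  rw [im_stieltjesTransform ν hz.ne', neg_lt_zero]
  have hpos (x : ℝ) : 0 < z.im * ((z.re - x) ^ 2 + z.im ^ 2)⁻¹ := by positivity
  rw [integral_pos_iff_support_of_nonneg (fun x ↦ (hpos x).le)]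
  · rw [Function.support_eq_univ (fun x ↦ (hpos x).ne')]
    simp
  · refine ((integrable_one_div_sub ν hz.ne').im.neg).congr (ae_of_all _ fun x ↦ ?_)
    change -(1 / (z - x)).im = _
    rw [im_one_div_sub_ofReal, neg_neg]

/-- `z S(ν, z)` tends to the total mass as `z` goes to infinity along the imaginary axis. -/
lemma tendsto_mul_stieltjesTransform (ν : Measure ℝ) [IsProbabilityMeasure ν] :
    Tendsto (fun y : ℝ ↦ (y * I) * stieltjesTransform ν (y * I)) atTop (𝓝 1) := by
  have h : Tendsto (fun y : ℝ ↦ ∫ x : ℝ, (y * I) * (1 / (y * I - x)) ∂ν) atTop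
      (𝓝 (∫ _ : ℝ, (1 : ℂ) ∂ν)) := by
    refine tendsto_integral_filter_of_dominated_convergence (fun _ ↦ 1)
      (Eventually.of_forall fun y ↦ by measurability) ?_ (integrable_const _)
      (ae_of_all _ fun x ↦ ?_)
    · filter_upwards [eventually_gt_atTop 0] with y hy
      refine ae_of_all _ fun x ↦ ?_
      have h1 := norm_one_div_sub_ofReal_le (z := y * I) (by simpa using hy.ne') x
      rw [norm_mul]
      refine (mul_le_mul_of_nonneg_left h1 (norm_nonneg _)).trans ?_
      simp [hy.ne']
    · have h2 : Tendsto (fun y : ℝ ↦ (1 - (x : ℂ) / I * ((y⁻¹ : ℝ) : ℂ))⁻¹) atTop (𝓝 1) := by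
        have : Tendsto (fun y : ℝ ↦ ((y⁻¹ : ℝ) : ℂ)) atTop (𝓝 ((0 : ℝ) : ℂ)) :=
          (continuous_ofReal.tendsto 0).comp tendsto_inv_atTop_zero
        simpa using ((this.const_mul ((x : ℂ) / I)).const_sub 1).inv₀ (by simp)
      refine h2.congr' ?_
      filter_upwards [eventually_gt_atTop 0] with y hy
      have h3 : (y : ℂ) ≠ 0 := by exact_mod_cast hy.ne'
      have h4 : (y : ℂ) * I - x ≠ 0 := sub_ofReal_ne_zero (by simpa using hy.ne') x
      have h5 : 1 - (x : ℂ) / I * ((y⁻¹ : ℝ) : ℂ) = (y * I - x) / (y * I) := by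
        push_cast
        field_simp [I_ne_zero]
      rw [h5, inv_div, mul_one_div]
  simpa [stieltjesTransform, integral_const_mul] using h

lemma tendsto_stieltjesTransform (ν : Measure ℝ) [IsProbabilityMeasure ν] :
    Tendsto (fun y : ℝ ↦ stieltjesTransform ν (y * I)) atTop (𝓝 0) := by
  have h : Tendsto (fun y : ℝ ↦ ((y⁻¹ : ℝ) : ℂ) * I⁻¹) atTop (𝓝 (((0 : ℝ) : ℂ) * I⁻¹)) :=
    ((continuous_ofReal.tendsto 0).comp tendsto_inv_atTop_zero).mul_const _
  have h2 := h.mul (tendsto_mul_stieltjesTransform ν)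
  rw [ofReal_zero, zero_mul, zero_mul] at h2
  refine h2.congr' ?_
  filter_upwards [eventually_gt_atTop 0] with y hy
  have h3 : (y : ℂ) ≠ 0 := by exact_mod_cast hy.ne'
  push_cast
  field_simp [I_ne_zero]

lemma isOpen_im_pos : IsOpen {w : ℂ | 0 < w.im} := isOpen_lt continuous_const continuous_im

lemma eq_of_hasDerivAt_zero {f : ℂ → ℂ} (hf : ∀ z : ℂ, 0 < z.im → HasDerivAt f 0 z) {z w : ℂ}
    (hz : 0 < z.im) (hw : 0 < w.im) : f z = f w := by
  have hconv : Convex ℝ {w : ℂ | 0 < w.im} := convex_halfSpace_im_gt 0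
  refine isOpen_im_pos.is_const_of_fderiv_eq_zero (𝕜 := ℂ) hconv.isPreconnected
    (fun w hw ↦ (hf w hw).differentiableAt.differentiableWithinAt) (fun w hw ↦ ?_) hz hw
  ext
  simp [(hf w hw).deriv]

/-- A holomorphic function on the upper half-plane with vanishing derivative equals its limit along
the imaginary axis. -/
lemma eq_of_hasDerivAt_zero_of_tendsto {f : ℂ → ℂ} {c : ℂ}
    (hf : ∀ z : ℂ, 0 < z.im → HasDerivAt f 0 z)
    (hc : Tendsto (fun y : ℝ ↦ f (y * I)) atTop (𝓝 c)) {z : ℂ} (hz : 0 < z.im) : f z = c := by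
  refine tendsto_nhds_unique (tendsto_const_nhds.congr' ?_) hc
  filter_upwards [eventually_gt_atTop 0] with y hy
  exact eq_of_hasDerivAt_zero hf hz (by simpa using hy)

/-- The Cauchy density, jointly in the location and the argument, is integrable against
the product of a finite measure and Lebesgue measure. -/
lemma integrable_prod_cauchyPDFReal (ν : Measure ℝ) [IsFiniteMeasure ν] {γ : NNReal} (hγ : γ ≠ 0) :
    Integrable (fun p : ℝ × ℝ ↦ cauchyPDFReal p.1 γ p.2) (ν.prod volume) := by
  rw [integrable_prod_iff]
  · refine ⟨ae_of_all _ fun t ↦ integrable_cauchyPDFReal t, ?_⟩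
    have h0 (t x : ℝ) : ‖cauchyPDFReal t γ x‖ = cauchyPDFReal t γ x :=
      Real.norm_of_nonneg (cauchyPDF_pos t hγ x).le
    simp only [h0, integral_cauchyPDFReal_eq_one _ hγ]
    exact integrable_const _
  · unfold cauchyPDFReal
    exact Measurable.aestronglyMeasurable (by fun_prop)

lemma integral_cauchyMeasure {E : Type*} [NormedAddCommGroup E] [NormedSpace ℝ E] (c : ℝ)
    {γ : NNReal} (hγ : γ ≠ 0) (f : ℝ → E) :
    ∫ x, f x ∂cauchyMeasure c γ = ∫ x, cauchyPDFReal c γ x • f x := by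
  rw [cauchyMeasure_of_scale_ne_zero c hγ,
    integral_withDensity_eq_integral_toReal_smul (measurable_cauchyPDF c γ)
      (ae_of_all _ fun x ↦ ENNReal.ofReal_lt_top)]
  congr with x
  rw [cauchyPDF, ENNReal.toReal_ofReal (cauchyPDF_pos c hγ x).le]

/-- The Cauchy distribution with location `t` and scale `γ` is the image of the standard one under
`s ↦ t + γ s`. -/
lemma integral_cauchyMeasure_comp_affine (t : ℝ) {γ : NNReal} (hγ : γ ≠ 0) (f : ℝ → ℝ) :
    ∫ s, f (t + γ * s) ∂cauchyMeasure 0 1 = ∫ x, cauchyPDFReal t γ x * f x := by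
  have hγ0 : (0 : ℝ) < γ := by positivity
  have h1 (s : ℝ) : cauchyPDFReal 0 1 s • f (t + γ * s) =
      γ * (cauchyPDFReal t γ (t + γ * s) * f (t + γ * s)) := by
    simp only [cauchyPDFReal_def, smul_eq_mul, NNReal.coe_one]
    field_simp
    ring
  rw [integral_cauchyMeasure 0 one_ne_zero]
  simp only [h1]
  rw [integral_const_mul,
    Measure.integral_comp_mul_left (fun u ↦ cauchyPDFReal t γ (t + u) * f (t + u)) (γ : ℝ),
    integral_add_left_eq_self (fun u ↦ cauchyPDFReal t γ u * f u) t, smul_eq_mul,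
    abs_of_pos (inv_pos.mpr hγ0), mul_inv_cancel_left₀ hγ0.ne']

/-- Integrating `f` against the convolution of `ν` with a centred Cauchy distribution of scale `γ`
amounts to integrating it against the imaginary part of the Stieltjes transform at height `γ`. -/
lemma integral_cauchy_smoothing (ν : Measure ℝ) [IsFiniteMeasure ν] {γ : NNReal} (hγ : γ ≠ 0)
    (f : BoundedContinuousFunction ℝ ℝ) :
    ∫ p, f (p.1 + γ * p.2) ∂(ν.prod (cauchyMeasure 0 1)) =
      ∫ x : ℝ, (-Real.pi⁻¹ * (stieltjesTransform ν (x + (γ : ℝ) * I)).im) * f x := by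
  have hint : Integrable (fun p : ℝ × ℝ ↦ f (p.1 + γ * p.2)) (ν.prod (cauchyMeasure 0 1)) :=
    Integrable.of_bound (f.continuous.comp (by fun_prop)).aestronglyMeasurable ‖f‖
      (ae_of_all _ fun p ↦ f.norm_coe_le_norm _)
  rw [integral_prod _ hint]
  simp only [integral_cauchyMeasure_comp_affine _ hγ]
  rw [integral_integral_swap]
  · congr with x
    rw [integral_mul_const]
    congr 1
    rw [im_stieltjesTransform ν (by simpa using hγ), neg_mul_neg, ← integral_const_mul]
    congr with t
    simp only [cauchyPDFReal_def, add_re, ofReal_re, mul_re, I_re, mul_zero, ofReal_im, I_im,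
      mul_one, sub_self, add_zero, add_im, mul_im, zero_add]
    ring
  · refine (integrable_prod_cauchyPDFReal ν hγ).mul_bdd (c := ‖f‖)
      (f.continuous.comp (by fun_prop)).aestronglyMeasurable
      (ae_of_all _ fun p ↦ f.norm_coe_le_norm _)

/-- **Stieltjes inversion**: a probability measure on `ℝ` is determined by its Stieltjes transform
on the upper half-plane. -/
theorem eq_of_stieltjesTransform_eq {ν₁ ν₂ : Measure ℝ} [IsProbabilityMeasure ν₁]
    [IsProbabilityMeasure ν₂]
    (h : ∀ z : ℂ, 0 < z.im → stieltjesTransform ν₁ z = stieltjesTransform ν₂ z) : ν₁ = ν₂ := by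
  refine ext_of_forall_integral_eq_of_IsFiniteMeasure fun f ↦ ?_
  have key (ν : Measure ℝ) [IsProbabilityMeasure ν] :
      Tendsto (fun γ : NNReal ↦ ∫ p, f (p.1 + γ * p.2) ∂(ν.prod (cauchyMeasure 0 1))) (𝓝[≠] 0)
        (𝓝 (∫ x, f x ∂ν)) := by
    have h0 : ∫ x, f x ∂ν = ∫ p, f (p.1 + (0 : NNReal) * p.2) ∂(ν.prod (cauchyMeasure 0 1)) := by
      simpa using (integral_fun_fst (μ := ν) (ν := cauchyMeasure 0 1) f).symm
    rw [h0]
    refine tendsto_nhdsWithin_of_tendsto_nhds <| tendsto_integral_filter_of_dominated_convergence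
      (fun _ ↦ ‖f‖) (Eventually.of_forall fun γ ↦
        (f.continuous.comp (by fun_prop)).aestronglyMeasurable)
      (Eventually.of_forall fun γ ↦ ae_of_all _ fun p ↦ f.norm_coe_le_norm _)
      (integrable_const _) (ae_of_all _ fun p ↦ ?_)
    have hc : Continuous fun γ : NNReal ↦ f (p.1 + γ * p.2) := f.continuous.comp (by fun_prop)
    exact hc.tendsto 0
  refine tendsto_nhds_unique (key ν₁) ((key ν₂).congr' ?_)
  filter_upwards [self_mem_nhdsWithin] with γ hγ
  have hγ' : γ ≠ 0 := hγ
  rw [integral_cauchy_smoothing ν₁ hγ', integral_cauchy_smoothing ν₂ hγ']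
  congr with x
  rw [h _ (by simpa using pos_of_ne_zero hγ')]

/-- A probability measure is already determined by the derivative of its Stieltjes transform on the
upper half-plane, because the transform vanishes at infinity. -/
theorem eq_of_hasDerivAt_stieltjesTransform {ν₁ ν₂ : Measure ℝ} [IsProbabilityMeasure ν₁]
    [IsProbabilityMeasure ν₂] {D : ℂ → ℂ}
    (h₁ : ∀ z : ℂ, 0 < z.im → HasDerivAt (stieltjesTransform ν₁) (D z) z)
    (h₂ : ∀ z : ℂ, 0 < z.im → HasDerivAt (stieltjesTransform ν₂) (D z) z) : ν₁ = ν₂ := by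
  refine eq_of_stieltjesTransform_eq fun z hz ↦ sub_eq_zero.mp ?_
  refine eq_of_hasDerivAt_zero_of_tendsto
    (f := fun z ↦ stieltjesTransform ν₁ z - stieltjesTransform ν₂ z) (fun w hw ↦ ?_) ?_ hz
  · exact ((h₁ w hw).sub (h₂ w hw)).congr_deriv (sub_self _)
  · simpa using (tendsto_stieltjesTransform ν₁).sub (tendsto_stieltjesTransform ν₂)

/-! ### The law of the directed power variable -/

/-- The law of `X₁ + (X₂ - X₁) V` with `X₁`, `X₂` of law `μ` and `V` uniform on `[0, 1]`, all three
independent. -/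
noncomputable def segmentLaw (μ : Measure ℝ) : Measure ℝ :=
  ((μ.prod μ).prod (volume.restrict (Set.Icc (0 : ℝ) 1))).map
    fun p ↦ p.1.1 + (p.1.2 - p.1.1) * p.2

instance isProbabilityMeasure_restrict_Icc_zero_one :
    IsProbabilityMeasure (volume.restrict (Set.Icc (0 : ℝ) 1)) := ⟨by simp⟩

instance isProbabilityMeasure_segmentLaw (μ : Measure ℝ) [IsProbabilityMeasure μ] :
    IsProbabilityMeasure (segmentLaw μ) :=
  Measure.isProbabilityMeasure_map (by fun_prop)

lemma measurable_directedPowerCDF (n : ℕ) (z : ℝ) :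
    Measurable fun x : ℝ × ℝ ↦ directedPowerCDF n x.1 x.2 z := by
  have h1 : MeasurableSet {x : ℝ × ℝ | max x.1 x.2 ≤ z} :=
    measurableSet_le (by fun_prop) (by fun_prop)
  have h2 : MeasurableSet {x : ℝ × ℝ | x.1 < z ∧ z < x.2} :=
    (measurableSet_lt measurable_fst measurable_const).inter
      (measurableSet_lt measurable_const measurable_snd)
  have h3 : MeasurableSet {x : ℝ × ℝ | x.2 < z ∧ z < x.1} :=
    (measurableSet_lt measurable_snd measurable_const).inter
      (measurableSet_lt measurable_const measurable_fst)
  unfold directedPowerCDF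
  exact Measurable.ite h1 (by fun_prop)
    (Measurable.ite h2 (by fun_prop) (Measurable.ite h3 (by fun_prop) (by fun_prop)))

lemma volume_segment_le (x₁ x₂ z : ℝ) :
    volume.restrict (Set.Icc (0 : ℝ) 1) {v | x₁ + (x₂ - x₁) * v ≤ z} =
      ENNReal.ofReal (directedPowerCDF 1 x₁ x₂ z) := by
  rw [Measure.restrict_apply (measurableSet_le (by fun_prop) (by fun_prop))]
  unfold directedPowerCDF
  split_ifs with h1 h2 h3
  · have : {v | x₁ + (x₂ - x₁) * v ≤ z} ∩ Set.Icc (0 : ℝ) 1 = Set.Icc 0 1 := by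
      rw [Set.inter_eq_right]
      rintro v ⟨hv0, hv1⟩
      simp only [Set.mem_ofPred_eq]
      nlinarith [max_le_iff.mp h1]
    rw [this]
    simp
  · have hd : 0 < x₂ - x₁ := by linarith
    have : {v | x₁ + (x₂ - x₁) * v ≤ z} ∩ Set.Icc (0 : ℝ) 1 =
        Set.Icc 0 ((z - x₁) / (x₂ - x₁)) := by
      ext v
      have h4 : (z - x₁) / (x₂ - x₁) ≤ 1 := by rw [div_le_one hd]; linarith
      simp only [Set.mem_inter_iff, Set.mem_ofPred_eq, Set.mem_Icc]
      have h5 : v ≤ (z - x₁) / (x₂ - x₁) ↔ x₁ + (x₂ - x₁) * v ≤ z := by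
        rw [le_div_iff₀ hd]
        constructor <;> intro <;> linarith
      grind
    rw [this]
    simp
  · have hd : x₂ - x₁ < 0 := by linarith
    have : {v | x₁ + (x₂ - x₁) * v ≤ z} ∩ Set.Icc (0 : ℝ) 1 =
        Set.Icc ((z - x₁) / (x₂ - x₁)) 1 := by
      ext v
      have h4 : 0 ≤ (z - x₁) / (x₂ - x₁) := div_nonneg_of_nonpos (by linarith) hd.le
      simp only [Set.mem_inter_iff, Set.mem_ofPred_eq, Set.mem_Icc]
      have h5 : (z - x₁) / (x₂ - x₁) ≤ v ↔ x₁ + (x₂ - x₁) * v ≤ z := by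
        rw [div_le_iff_of_neg hd]
        constructor <;> intro <;> linarith
      grind
    rw [this]
    simp
  · rw [ENNReal.ofReal_zero]
    -- Here `z` lies strictly below the larger endpoint and not strictly above the smaller one, so
    -- only an endpoint of `[0, 1]` can satisfy the inequality.
    refine measure_mono_null (t := {0, 1}) ?_ (by simp [Set.Finite.measure_zero])
    rintro v ⟨hv, hv0, hv1⟩
    simp only [Set.mem_ofPred_eq] at hv
    by_contra hne
    simp only [Set.mem_insert_iff, Set.mem_singleton_iff, not_or] at hne
    have hv0' := lt_of_le_of_ne hv0 (Ne.symm hne.1)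
    have hv1' := lt_of_le_of_ne hv1 hne.2
    rw [max_le_iff] at h1
    rcases lt_trichotomy x₁ x₂ with h | h | h
    · have h6 : z ≤ x₁ := by grind
      nlinarith
    · grind
    · have h6 : z ≤ x₂ := by grind
      nlinarith

lemma directedPowerCDF_nonneg (n : ℕ) (x₁ x₂ z : ℝ) :
    0 ≤ directedPowerCDF n x₁ x₂ z := by
  unfold directedPowerCDF
  split_ifs with h1 h2 h3
  · norm_num
  · exact pow_nonneg (div_nonneg (by linarith) (by linarith)) n
  · rw [sub_nonneg]
    refine pow_le_one₀ (div_nonneg_of_nonpos (by linarith) (by linarith)) ?_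
    rw [div_le_one_of_neg (by linarith)]
    linarith
  · exact le_rfl

/-- Symmetrizing the directed triangular distribution gives the uniform distribution: with
`t = (z - x₁) / (x₂ - x₁)` this is `t² + (1 - (1 - t)²) = 2t`. -/
lemma directedPowerCDF_two_add_swap (x₁ x₂ z : ℝ) :
    directedPowerCDF 2 x₁ x₂ z + directedPowerCDF 2 x₂ x₁ z = 2 * directedPowerCDF 1 x₁ x₂ z := by
  unfold directedPowerCDF
  rw [max_comm x₂ x₁]
  split_ifs with h1 h2 h3 h3
  · norm_num
  · exact absurd h2 (by grind)
  · have : x₂ - x₁ ≠ 0 := by linarith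
    have : x₁ - x₂ ≠ 0 := by linarith
    field_simp
    ring
  · have : x₂ - x₁ ≠ 0 := by linarith
    have : x₁ - x₂ ≠ 0 := by linarith
    field_simp
    ring
  · norm_num

lemma segmentLaw_Iic (μ : Measure ℝ) [IsProbabilityMeasure μ] (z : ℝ) :
    segmentLaw μ (Set.Iic z) = ∫⁻ x, ENNReal.ofReal (directedPowerCDF 1 x.1 x.2 z) ∂(μ.prod μ) := by
  rw [segmentLaw, Measure.map_apply (by fun_prop) measurableSet_Iic,
    Measure.prod_apply ((measurableSet_Iic).preimage (by fun_prop))]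
  congr with x
  exact volume_segment_le x.1 x.2 z

lemma lintegral_directedPowerCDF (μ : Measure ℝ) [IsProbabilityMeasure μ] {n : ℕ}
    (hn : n = 1 ∨ n = 2) (z : ℝ) :
    ∫⁻ x, ENNReal.ofReal (directedPowerCDF n x.1 x.2 z) ∂(μ.prod μ) =
      ∫⁻ x, ENNReal.ofReal (directedPowerCDF 1 x.1 x.2 z) ∂(μ.prod μ) := by
  rcases hn with rfl | rfl
  · rfl
  have hm := (measurable_directedPowerCDF 2 z).ennreal_ofReal
  have hswap : ∫⁻ x, ENNReal.ofReal (directedPowerCDF 2 x.2 x.1 z) ∂(μ.prod μ) =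
      ∫⁻ x, ENNReal.ofReal (directedPowerCDF 2 x.1 x.2 z) ∂(μ.prod μ) :=
    lintegral_prod_swap (μ := μ) (ν := μ)
      (f := fun x ↦ ENNReal.ofReal (directedPowerCDF 2 x.1 x.2 z))
  refine (ENNReal.mul_right_inj two_ne_zero ENNReal.ofNat_ne_top).mp ?_
  rw [two_mul]
  nth_rewrite 2 [← hswap]
  rw [← lintegral_add_left hm, ← lintegral_const_mul' _ _ ENNReal.ofNat_ne_top]
  congr with x
  rw [← ENNReal.ofReal_add (directedPowerCDF_nonneg 2 _ _ _)
    (directedPowerCDF_nonneg 2 _ _ _), directedPowerCDF_two_add_swap,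
    ENNReal.ofReal_mul two_pos.le, ENNReal.ofReal_ofNat]

section

variable {Ω : Type*} [MeasurableSpace Ω] {P : Measure Ω} [IsProbabilityMeasure P]
  {n : ℕ} {μ : Measure ℝ} {X₁ X₂ Z : Ω → ℝ}

lemma IsDirectedPower.isProbabilityMeasure (h : IsDirectedPower P n μ X₁ X₂ Z) :
    IsProbabilityMeasure μ :=
  h.law_fst ▸ Measure.isProbabilityMeasure_map h.measurable_fst.aemeasurable

/-- The law of a directed power variable with exponent one or two is that of a uniformly chosen
point of the segment from `X₁` to `X₂`. -/
theorem IsDirectedPower.map_eq_segmentLaw (h : IsDirectedPower P n μ X₁ X₂ Z)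
    (hn : n = 1 ∨ n = 2) : P.map Z = segmentLaw μ := by
  have := h.isProbabilityMeasure
  have : IsProbabilityMeasure (P.map Z) :=
    Measure.isProbabilityMeasure_map h.measurable_between.aemeasurable
  have hX : Measurable fun ω ↦ (X₁ ω, X₂ ω) := h.measurable_fst.prodMk h.measurable_snd
  have hlaw : P.map (fun ω ↦ (X₁ ω, X₂ ω)) = μ.prod μ := by
    rw [(indepFun_iff_map_prod_eq_prod_map_map h.measurable_fst.aemeasurable
      h.measurable_snd.aemeasurable).mp h.indep, h.law_fst, h.law_snd]
  refine Measure.ext_of_Iic _ _ fun z ↦ ?_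
  rw [segmentLaw_Iic, ← lintegral_directedPowerCDF μ hn z, ← hlaw,
    ← condDistrib_comp_map hX.aemeasurable h.measurable_between.aemeasurable,
    Measure.bind_apply measurableSet_Iic (Kernel.aemeasurable _)]
  refine lintegral_congr_ae ?_
  filter_upwards [h.cond_law] with x hx
  rw [← hx z, ofReal_cdf]

end

/-! ### The Stieltjes equation -/

/-- The antiderivative `v / ((z - x₁) (z - x₁ - v (x₂ - x₁)))` is valid also for `x₁ = x₂`. -/
lemma integral_one_div_sub_segment_sq {z : ℂ} (hz : z.im ≠ 0) (x₁ x₂ : ℝ) :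
    ∫ v in Set.Icc (0 : ℝ) 1, 1 / (z - ((x₁ + (x₂ - x₁) * v : ℝ) : ℂ)) ^ 2 =
      1 / (z - x₁) * (1 / (z - x₂)) := by
  have hne (v : ℝ) : z - ((x₁ + (x₂ - x₁) * v : ℝ) : ℂ) ≠ 0 := sub_ofReal_ne_zero hz _
  have hd (v : ℝ) : HasDerivAt
      (fun v : ℝ ↦ (v : ℂ) / ((z - x₁) * (z - ((x₁ + (x₂ - x₁) * v : ℝ) : ℂ))))
      (1 / (z - ((x₁ + (x₂ - x₁) * v : ℝ) : ℂ)) ^ 2) v := by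
    have h1 : HasDerivAt (fun v : ℝ ↦ (v : ℂ)) 1 v := hasDerivAt_id v |>.ofReal_comp
    have h2 : HasDerivAt (fun v : ℝ ↦ ((x₁ + (x₂ - x₁) * v : ℝ) : ℂ)) ((x₂ - x₁ : ℝ) : ℂ) v := by
      have := (((hasDerivAt_id v).const_mul (x₂ - x₁)).const_add x₁).ofReal_comp
      simpa using this
    refine (h1.div ((h2.const_sub z).const_mul (z - x₁))
      (mul_ne_zero (sub_ofReal_ne_zero hz x₁) (hne v))).congr_deriv ?_
    have h3 := hne v
    have h4 := sub_ofReal_ne_zero hz x₁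
    push_cast at h3 ⊢
    field_simp
    ring
  rw [integral_Icc_eq_integral_Ioc, ← intervalIntegral.integral_of_le zero_le_one,
    intervalIntegral.integral_eq_sub_of_hasDerivAt (fun v _ ↦ hd v)]
  · simp [mul_comm]
  · refine Continuous.intervalIntegrable ?_ _ _
    exact continuous_const.div (by fun_prop) fun v ↦ pow_ne_zero 2 (hne v)

lemma integral_segmentLaw (μ : Measure ℝ) [IsProbabilityMeasure μ] {z : ℂ} (hz : z.im ≠ 0) :
    ∫ x : ℝ, 1 / (z - x) ^ 2 ∂segmentLaw μ = stieltjesTransform μ z ^ 2 := by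
  have hint := (integrable_one_div_sub_sq (segmentLaw μ) hz)
  rw [segmentLaw, integrable_map_measure hint.aestronglyMeasurable (by fun_prop)] at hint
  rw [segmentLaw, integral_map (by fun_prop) (integrable_one_div_sub_sq _ hz).aestronglyMeasurable,
    integral_prod (fun p : (ℝ × ℝ) × ℝ ↦
      1 / (z - ((p.1.1 + (p.1.2 - p.1.1) * p.2 : ℝ) : ℂ)) ^ 2) hint]
  simp only [integral_one_div_sub_segment_sq hz]
  rw [sq, stieltjesTransform,
    integral_prod_mul (fun x : ℝ ↦ 1 / (z - (x : ℂ))) (fun x : ℝ ↦ 1 / (z - (x : ℂ)))]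

lemma hasDerivAt_stieltjesTransform_segmentLaw_of_im_ne_zero (μ : Measure ℝ)
    [IsProbabilityMeasure μ] {z : ℂ} (hz : z.im ≠ 0) :
    HasDerivAt (stieltjesTransform (segmentLaw μ)) (-(stieltjesTransform μ z) ^ 2) z := by
  rw [← integral_segmentLaw μ hz]
  exact hasDerivAt_stieltjesTransform fun x _ ↦ ofReal_ne_of_im_ne_zero hz x

/-- The Stieltjes equation extends from the non-real points to the real points outside both supports
since both sides are continuous there. -/
theorem hasDerivAt_stieltjesTransform_segmentLaw (μ : Measure ℝ) [IsProbabilityMeasure μ] {z : ℂ}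
    (hμ : ∀ x ∈ μ.support, (x : ℂ) ≠ z) (hs : ∀ x ∈ (segmentLaw μ).support, (x : ℂ) ≠ z) :
    HasDerivAt (stieltjesTransform (segmentLaw μ)) (-(stieltjesTransform μ z) ^ 2) z := by
  by_cases hz : z.im = 0
  swap
  · exact hasDerivAt_stieltjesTransform_segmentLaw_of_im_ne_zero μ hz
  have hopen := isOpen_compl_image_support (segmentLaw μ)
  have hdiff : DifferentiableOn ℂ (stieltjesTransform (segmentLaw μ))
      {z : ℂ | ∀ x ∈ (segmentLaw μ).support, (x : ℂ) ≠ z} := fun w hw ↦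
    (hasDerivAt_stieltjesTransform hw).differentiableAt.differentiableWithinAt
  have h1 : ContinuousAt (deriv (stieltjesTransform (segmentLaw μ))) z :=
    ((hdiff.deriv hopen).differentiableAt (hopen.mem_nhds hs)).continuousAt
  have h2 : ContinuousAt (fun w ↦ -(stieltjesTransform μ w) ^ 2) z :=
    ((hasDerivAt_stieltjesTransform hμ).continuousAt.pow 2).neg
  have hpath : Tendsto (fun t : ℝ ↦ z + t * I) (𝓝[≠] 0) (𝓝 z) := by
    have : Continuous fun t : ℝ ↦ z + t * I := by fun_prop
    exact tendsto_nhdsWithin_of_tendsto_nhds (by simpa using this.tendsto 0)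
  have heq : deriv (stieltjesTransform (segmentLaw μ)) z = -(stieltjesTransform μ z) ^ 2 := by
    refine tendsto_nhds_unique (h1.tendsto.comp hpath) ((h2.tendsto.comp hpath).congr' ?_)
    filter_upwards [self_mem_nhdsWithin] with t ht
    exact (hasDerivAt_stieltjesTransform_segmentLaw_of_im_ne_zero μ
      (by simpa [hz] using ht)).deriv.symm
  rw [← heq]
  exact (hasDerivAt_stieltjesTransform hs).differentiableAt.hasDerivAt

/-! ### The uniform and the arcsine distribution -/

lemma hasDerivAt_ofReal (x : ℝ) : HasDerivAt (fun x : ℝ ↦ (x : ℂ)) 1 x :=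
  (hasDerivAt_id x).ofReal_comp

lemma hasDerivAt_one_div_sub_ofReal {z : ℂ} (hz : z.im ≠ 0) (x : ℝ) :
    HasDerivAt (fun x : ℝ ↦ 1 / (z - x)) (1 / (z - x) ^ 2) x := by
  have h1 : HasDerivAt (fun x : ℝ ↦ z - (x : ℂ)) (-1) x := (hasDerivAt_ofReal x).const_sub z
  simp only [one_div]
  refine (h1.inv (sub_ofReal_ne_zero hz x)).congr_deriv ?_
  rw [neg_neg, one_div]

lemma sq_sub_one_ne_zero {z : ℂ} (hz : z.im ≠ 0) : z ^ 2 - 1 ≠ 0 := by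
  have h1 := sub_ofReal_ne_zero hz 1
  have h2 := sub_ofReal_ne_zero hz (-1)
  push_cast at h1 h2
  rw [show z ^ 2 - 1 = (z - 1) * (z - -1) by ring]
  exact mul_ne_zero h1 h2

instance isProbabilityMeasure_cond_Icc :
    IsProbabilityMeasure (cond (volume : Measure ℝ) (Set.Icc (-1) 1)) :=
  cond_isProbabilityMeasure_of_finite (by simp) (by simp)

lemma hasDerivAt_stieltjesTransform_uniform {z : ℂ} (hz : z.im ≠ 0) :
    HasDerivAt (stieltjesTransform (cond (volume : Measure ℝ) (Set.Icc (-1) 1)))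
      (-(1 / (z ^ 2 - 1))) z := by
  refine (hasDerivAt_stieltjesTransform
    fun x _ ↦ ofReal_ne_of_im_ne_zero hz x).congr_deriv (congr_arg _ ?_)
  have h1 := sub_ofReal_ne_zero hz 1
  have h2 := sub_ofReal_ne_zero hz (-1)
  have h3 := sq_sub_one_ne_zero hz
  have hcont : Continuous fun x : ℝ ↦ 1 / (z - (x : ℂ)) ^ 2 :=
    continuous_const.div (by fun_prop) fun x ↦ pow_ne_zero 2 (sub_ofReal_ne_zero hz x)
  rw [ProbabilityTheory.cond, integral_smul_measure, integral_Icc_eq_integral_Ioc,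
    ← intervalIntegral.integral_of_le (by norm_num),
    intervalIntegral.integral_eq_sub_of_hasDerivAt
      (fun x _ ↦ hasDerivAt_one_div_sub_ofReal hz x) (hcont.intervalIntegrable _ _)]
  have h4 : ((volume (Set.Icc (-1 : ℝ) 1))⁻¹).toReal = 1 / 2 := by
    rw [Real.volume_Icc]
    norm_num
  rw [h4, real_smul]
  push_cast at h1 h2 ⊢
  field_simp
  ring

lemma hasDerivAt_arcsin_of_mem_Ioo {x : ℝ} (hx : x ∈ Set.Ioo (-1 : ℝ) 1) :
    HasDerivAt (fun x ↦ Real.pi⁻¹ * Real.arcsin x) (1 / (Real.pi * √(1 - x ^ 2))) x := by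
  refine ((Real.hasDerivAt_arcsin hx.1.ne' hx.2.ne).const_mul _).congr_deriv ?_
  rw [one_div, one_div, mul_inv]

lemma intervalIntegrable_arcsine_density :
    IntervalIntegrable (fun x ↦ 1 / (Real.pi * √(1 - x ^ 2))) volume (-1) 1 :=
  intervalIntegral.intervalIntegrable_deriv_of_nonneg (g := fun x ↦ Real.pi⁻¹ * Real.arcsin x)
    (by fun_prop) (fun x hx ↦ hasDerivAt_arcsin_of_mem_Ioo (by simpa using hx))
    (fun x _ ↦ by positivity)

lemma integral_arcsine_density : ∫ x in (-1 : ℝ)..1, 1 / (Real.pi * √(1 - x ^ 2)) = 1 := by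
  rw [intervalIntegral.integral_eq_sub_of_hasDerivAt_of_le (by norm_num) (by fun_prop)
    (fun x hx ↦ hasDerivAt_arcsin_of_mem_Ioo hx) intervalIntegrable_arcsine_density]
  simp only [Real.arcsin_one, Real.arcsin_neg_one]
  field_simp [Real.pi_ne_zero]
  norm_num

instance isProbabilityMeasure_arcsineMeasure : IsProbabilityMeasure arcsineMeasure := by
  constructor
  have hint := intervalIntegrable_arcsine_density
  rw [intervalIntegrable_iff_integrableOn_Ioo_of_le (by norm_num)] at hint
  rw [arcsineMeasure, withDensity_apply _ MeasurableSet.univ, Measure.restrict_univ,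
    ← ofReal_integral_eq_lintegral_ofReal hint (ae_of_all _ fun x ↦ by positivity),
    ← integral_Ioc_eq_integral_Ioo, ← intervalIntegral.integral_of_le (by norm_num),
    integral_arcsine_density, ENNReal.ofReal_one]

lemma integral_arcsineMeasure (f : ℝ → ℂ) :
    ∫ x, f x ∂arcsineMeasure =
      ∫ x in (-1 : ℝ)..1, (1 / (Real.pi * √(1 - x ^ 2))) • f x := by
  rw [arcsineMeasure, integral_withDensity_eq_integral_toReal_smul (by fun_prop)
      (ae_of_all _ fun x ↦ ENNReal.ofReal_lt_top), intervalIntegral.integral_of_le (by norm_num),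
    integral_Ioc_eq_integral_Ioo]
  congr with x
  rw [ENNReal.toReal_ofReal (by positivity)]

lemma intervalIntegrable_arcsine_density_smul {f : ℝ → ℂ} (hf : Integrable f arcsineMeasure) :
    IntervalIntegrable (fun x ↦ (1 / (Real.pi * √(1 - x ^ 2))) • f x) volume (-1) 1 := by
  rw [arcsineMeasure, integrable_withDensity_iff_integrable_smul' (by fun_prop)
    (ae_of_all _ fun x ↦ ENNReal.ofReal_lt_top)] at hf
  rw [intervalIntegrable_iff_integrableOn_Ioo_of_le (by norm_num)]
  refine hf.congr (ae_of_all _ fun x ↦ ?_)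
  simp only
  rw [ENNReal.toReal_ofReal (by positivity)]

/-- Integrating the derivative of `√(1 - x²) / (z - x)`, which vanishes at both endpoints, gives a
first-order linear differential equation for the Stieltjes transform of the arcsine law. -/
lemma sq_sub_one_mul_integral_arcsineMeasure {z : ℂ} (hz : z.im ≠ 0) :
    (z ^ 2 - 1) * ∫ x : ℝ, 1 / (z - x) ^ 2 ∂arcsineMeasure =
      z * stieltjesTransform arcsineMeasure z := by
  have i1 := (integrable_one_div_sub arcsineMeasure hz).const_mul z
  have i2 := (integrable_one_div_sub_sq arcsineMeasure hz).const_mul (z ^ 2 - 1)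
  have key :
      ∫ x : ℝ, (z * (1 / (z - x)) - (z ^ 2 - 1) * (1 / (z - x) ^ 2)) ∂arcsineMeasure = 0 := by
    have hcont : ContinuousOn (fun x : ℝ ↦ (((Real.pi⁻¹ * √(1 - x ^ 2) : ℝ) : ℂ)) * (1 / (z - x)))
        (Set.Icc (-1) 1) := by
      refine Continuous.continuousOn (Continuous.mul (by fun_prop) ?_)
      exact continuous_const.div (by fun_prop) fun x ↦ sub_ofReal_ne_zero hz x
    rw [integral_arcsineMeasure, intervalIntegral.integral_eq_sub_of_hasDerivAt_of_le
      (by norm_num) hcont (fun x hx ↦ ?_) ?_]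
    · simp
    · exact intervalIntegrable_arcsine_density_smul (i1.sub i2)
    · have hpos : 0 < 1 - x ^ 2 := by nlinarith [hx.1, hx.2]
      have h1 : HasDerivAt (fun x : ℝ ↦ Real.pi⁻¹ * √(1 - x ^ 2))
          (Real.pi⁻¹ * (-(2 * x) / (2 * √(1 - x ^ 2)))) x := by
        have h0 : HasDerivAt (fun x : ℝ ↦ 1 - x ^ 2) (-(2 * x)) x := by
          simpa using (hasDerivAt_pow 2 x).const_sub 1
        exact (h0.sqrt hpos.ne').const_mul _
      refine (h1.ofReal_comp.mul (hasDerivAt_one_div_sub_ofReal hz x)).congr_deriv ?_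
      have h2 := sub_ofReal_ne_zero hz x
      have h3 : ((√(1 - x ^ 2) : ℝ) : ℂ) ≠ 0 := by
        exact_mod_cast (Real.sqrt_pos.mpr hpos).ne'
      have h4 : ((√(1 - x ^ 2) : ℝ) : ℂ) ^ 2 = 1 - (x : ℂ) ^ 2 := by
        exact_mod_cast Real.sq_sqrt hpos.le
      have h5 : (Real.pi : ℂ) ≠ 0 := by exact_mod_cast Real.pi_ne_zero
      rw [real_smul]
      push_cast
      field_simp
      rw [h4]
      ring
  rw [integral_sub i1 i2, integral_const_mul, integral_const_mul, sub_eq_zero] at key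
  exact key.symm

theorem stieltjesTransform_arcsineMeasure_sq {z : ℂ} (hz : 0 < z.im) :
    stieltjesTransform arcsineMeasure z ^ 2 = 1 / (z ^ 2 - 1) := by
  have h : (z ^ 2 - 1) * stieltjesTransform arcsineMeasure z ^ 2 = 1 := by
    refine eq_of_hasDerivAt_zero_of_tendsto
      (f := fun z ↦ (z ^ 2 - 1) * stieltjesTransform arcsineMeasure z ^ 2) (fun w hw ↦ ?_) ?_ hz
    · have h1 : HasDerivAt (fun z : ℂ ↦ z ^ 2 - 1) (2 * w) w := by
        simpa using (hasDerivAt_pow 2 w).sub_const 1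
      have h2 := hasDerivAt_stieltjesTransform (ν := arcsineMeasure)
        (fun x _ ↦ ofReal_ne_of_im_ne_zero hw.ne' x)
      refine (h1.mul (h2.pow 2)).congr_deriv ?_
      have h3 := sq_sub_one_mul_integral_arcsineMeasure hw.ne'
      simp only [Nat.cast_ofNat, Nat.add_one_sub_one, pow_one, Pi.pow_apply]
      linear_combination (-2 * stieltjesTransform arcsineMeasure w) * h3
    · have h1 := ((tendsto_mul_stieltjesTransform arcsineMeasure).pow 2).sub
        ((tendsto_stieltjesTransform arcsineMeasure).pow 2)
      rw [one_pow, zero_pow two_ne_zero, sub_zero] at h1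
      refine h1.congr fun y ↦ ?_
      ring
  rw [eq_div_iff (sq_sub_one_ne_zero hz.ne'), mul_comm, h]

theorem segmentLaw_eq_uniform_iff (μ : Measure ℝ) [IsProbabilityMeasure μ] :
    segmentLaw μ = cond volume (Set.Icc (-1) 1) ↔ μ = arcsineMeasure := by
  constructor
  · intro h
    refine eq_of_stieltjesTransform_eq fun z hz ↦ ?_
    have h1 := hasDerivAt_stieltjesTransform_segmentLaw_of_im_ne_zero μ hz.ne'
    rw [h] at h1
    have h2 := h1.unique (hasDerivAt_stieltjesTransform_uniform hz.ne')
    rw [neg_inj, ← stieltjesTransform_arcsineMeasure_sq hz, sq_eq_sq_iff_eq_or_eq_neg] at h2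
    -- The sign is determined because both transforms have negative imaginary part.
    refine h2.resolve_right fun h3 ↦ ?_
    have h4 := im_stieltjesTransform_neg μ hz
    rw [h3, neg_im, neg_lt_zero] at h4
    exact h4.not_gt (im_stieltjesTransform_neg arcsineMeasure hz)
  · rintro rfl
    refine eq_of_hasDerivAt_stieltjesTransform (fun z hz ↦ ?_)
      (fun z hz ↦ hasDerivAt_stieltjesTransform_uniform hz.ne')
    rw [← stieltjesTransform_arcsineMeasure_sq hz]
    exact hasDerivAt_stieltjesTransform_segmentLaw_of_im_ne_zero _ hz.ne'

/-! ### Point masses and the Cauchy distribution -/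

lemma tendsto_one_div_sub_ofReal_cocompact (z : ℂ) :
    Tendsto (fun x : ℝ ↦ 1 / (z - x)) (cocompact ℝ) (𝓝 0) := by
  simp only [one_div]
  refine tendsto_inv₀_cobounded.comp (tendsto_norm_atTop_iff_cobounded.mp ?_)
  refine tendsto_atTop_mono (fun x ↦ ?_)
    (tendsto_atTop_add_const_right _ (-‖z‖) (tendsto_norm_cocompact_atTop (E := ℝ)))
  have h := norm_sub_norm_le (x : ℂ) z
  rwa [norm_real, norm_sub_rev, sub_eq_add_neg] at h

lemma integral_one_div_sub_sq_volume {z : ℂ} (hz : 0 < z.im) :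
    ∫ x : ℝ, 1 / (z - x) ^ 2 = 0 := by
  have hint : Integrable fun x : ℝ ↦ 1 / (z - x) ^ 2 := by
    lift z.im to NNReal using hz.le with γ hγ
    refine ((integrable_cauchyPDFReal z.re (γ := γ)).const_mul (Real.pi * (γ : ℝ)⁻¹)).mono'
      (by measurability) (ae_of_all _ fun x ↦ ?_)
    rw [norm_div, norm_one, norm_pow, ← normSq_eq_norm_sq, normSq_apply, cauchyPDFReal_def]
    simp only [sub_re, ofReal_re, sub_im, ofReal_im, sub_zero, ← hγ]
    field_simp
    rw [← neg_sub x, neg_sq]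
  have hlim := tendsto_one_div_sub_ofReal_cocompact z
  rw [integral_of_hasDerivAt_of_tendsto (fun x ↦ hasDerivAt_one_div_sub_ofReal hz.ne' x) hint
    (hlim.mono_left atBot_le_cocompact) (hlim.mono_left atTop_le_cocompact), sub_zero]

/-- Multiplying the Cauchy density by `(x - c)² + γ²` leaves a constant, and `1 / (z - x)²`
integrates to zero over the real line. -/
lemma cauchyMeasure_linear_equation (c : ℝ) {γ : NNReal} (hγ : γ ≠ 0) {z : ℂ} (hz : 0 < z.im) :
    ((z - c) ^ 2 + (γ : ℝ) ^ 2) * ∫ x : ℝ, 1 / (z - x) ^ 2 ∂cauchyMeasure c γ -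
      2 * (z - c) * stieltjesTransform (cauchyMeasure c γ) z + 1 = 0 := by
  have i1 := (integrable_one_div_sub_sq (cauchyMeasure c γ) hz.ne').const_mul
    ((z - c) ^ 2 + (γ : ℝ) ^ 2)
  have i2 := (integrable_one_div_sub (cauchyMeasure c γ) hz.ne').const_mul (2 * (z - c))
  have key : ∫ x : ℝ, (((z - c) ^ 2 + (γ : ℝ) ^ 2) * (1 / (z - x) ^ 2) -
      2 * (z - c) * (1 / (z - x)) + 1) ∂cauchyMeasure c γ = 0 := by
    have h1 (x : ℝ) : cauchyPDFReal c γ x • (((z - c) ^ 2 + (γ : ℝ) ^ 2) * (1 / (z - x) ^ 2) -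
        2 * (z - c) * (1 / (z - x)) + 1) =
        ((Real.pi⁻¹ * γ : ℝ) : ℂ) * (1 / (z - x) ^ 2) := by
      have h2 := sub_ofReal_ne_zero hz.ne' x
      have h3 : ((x : ℂ) - c) ^ 2 + (γ : ℝ) ^ 2 ≠ 0 := by
        have : 0 < (x - c) ^ 2 + (γ : ℝ) ^ 2 := by positivity
        exact_mod_cast this.ne'
      have h5 : (Real.pi : ℂ) ≠ 0 := by exact_mod_cast Real.pi_ne_zero
      rw [real_smul, cauchyPDFReal_def]
      push_cast
      field_simp
      ring
    rw [integral_cauchyMeasure c hγ]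
    simp only [h1]
    rw [integral_const_mul, integral_one_div_sub_sq_volume hz, mul_zero]
  rw [integral_add ?_ (integrable_const _), integral_sub i1 i2, integral_const_mul,
    integral_const_mul] at key
  · simpa [stieltjesTransform] using key
  · exact i1.sub i2

theorem stieltjesTransform_cauchyMeasure (c : ℝ) (γ : NNReal) {z : ℂ} (hz : 0 < z.im) :
    stieltjesTransform (cauchyMeasure c γ) z = 1 / (z - (c - (γ : ℝ) * I)) := by
  by_cases hγ : γ = 0
  · simp [hγ, stieltjesTransform]
  have hγ0 : 0 < (γ : ℝ) := by positivity
  have hfac (w : ℂ) : (w - c) ^ 2 + (γ : ℝ) ^ 2 =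
      (w - (c + (γ : ℝ) * I)) * (w - (c - (γ : ℝ) * I)) := by
    linear_combination (((γ : ℝ) : ℂ) ^ 2) * I_sq
  have hne : z - (c - (γ : ℝ) * I) ≠ 0 := by
    intro h
    have := congr_arg im h
    simp at this
    linarith
  rw [eq_div_iff hne]
  by_cases hzc : z = c + (γ : ℝ) * I
  · -- At `c + iγ` the coefficient of the derivative vanishes.
    have h := cauchyMeasure_linear_equation c hγ hz
    rw [hfac, hzc] at h
    rw [hzc]
    linear_combination -h
  have hpos : 0 < ((c : ℂ) + (γ : ℝ) * I).im := by simpa using hγ0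
  have h := eq_of_hasDerivAt_zero
    (f := fun w ↦ ((w - c) ^ 2 + (γ : ℝ) ^ 2) * stieltjesTransform (cauchyMeasure c γ) w - w)
    (fun w hw ↦ ?_) hz hpos
  · simp only [hfac, sub_self, zero_mul, zero_sub] at h
    refine mul_left_cancel₀ (sub_ne_zero.mpr hzc) ?_
    linear_combination h
  · have h1 : HasDerivAt (fun w : ℂ ↦ (w - c) ^ 2 + (γ : ℝ) ^ 2) (2 * (w - c)) w := by
      simpa using (((hasDerivAt_id w).sub_const (c : ℂ)).pow 2).add_const (((γ : ℝ) : ℂ) ^ 2)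
    have h2 := hasDerivAt_stieltjesTransform (ν := cauchyMeasure c γ)
        (fun x _ ↦ ofReal_ne_of_im_ne_zero hw.ne' x)
    refine ((h1.mul h2).sub (hasDerivAt_id w)).congr_deriv ?_
    linear_combination -cauchyMeasure_linear_equation c hγ hw

theorem segmentLaw_eq_self_iff (μ : Measure ℝ) [IsProbabilityMeasure μ] :
    segmentLaw μ = μ ↔ ∃ (c : ℝ) (γ : NNReal), μ = cauchyMeasure c γ := by
  constructor
  · intro h
    have hne {z : ℂ} (hz : 0 < z.im) : stieltjesTransform μ z ≠ 0 := fun h0 ↦ by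
      simpa [h0] using im_stieltjesTransform_neg μ hz
    -- The equation `S' = -S²` says that `1 / S` has derivative `1`.
    have hconst {z : ℂ} (hz : 0 < z.im) :
        (stieltjesTransform μ z)⁻¹ - z = (stieltjesTransform μ I)⁻¹ - I := by
      refine eq_of_hasDerivAt_zero (f := fun z ↦ (stieltjesTransform μ z)⁻¹ - z)
        (fun w hw ↦ ?_) hz (by simp)
      have h1 := hasDerivAt_stieltjesTransform_segmentLaw_of_im_ne_zero μ hw.ne'
      rw [h] at h1
      refine ((h1.inv (hne hw)).sub (hasDerivAt_id w)).congr_deriv ?_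
      rw [neg_neg, div_self (pow_ne_zero 2 (hne hw)), sub_self]
    set a : ℂ := I - (stieltjesTransform μ I)⁻¹ with ha
    have hS {z : ℂ} (hz : 0 < z.im) : (stieltjesTransform μ z)⁻¹ = z - a := by
      linear_combination hconst hz
    have hpos {z : ℂ} (hz : 0 < z.im) : a.im < z.im := by
      have h1 : 0 < ((stieltjesTransform μ z)⁻¹).im := by
        rw [inv_im]
        exact div_pos (neg_pos.mpr (im_stieltjesTransform_neg μ hz)) (normSq_pos.mpr (hne hz))
      rwa [hS hz, sub_im, sub_pos] at h1
    have ha0 : a.im ≤ 0 := le_of_forall_pos_lt_add fun y hy ↦ by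
      simpa using hpos (z := y * I) (by simpa using hy)
    lift -a.im to NNReal using neg_nonneg.mpr ha0 with γ hγ
    refine ⟨a.re, γ, eq_of_stieltjesTransform_eq fun z hz ↦ ?_⟩
    rw [stieltjesTransform_cauchyMeasure _ _ hz, one_div, ← inv_inj, inv_inv, hS hz]
    congr 1
    apply Complex.ext <;> simp [hγ]
  · rintro ⟨c, γ, rfl⟩
    refine eq_of_hasDerivAt_stieltjesTransform
      (fun z hz ↦ hasDerivAt_stieltjesTransform_segmentLaw_of_im_ne_zero _ hz.ne') fun z hz ↦ ?_
    have hne : z - (c - (γ : ℝ) * I) ≠ 0 := by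
      intro h
      have := congr_arg im h
      simp at this
      linarith [γ.coe_nonneg]
    have h1 : HasDerivAt (fun w : ℂ ↦ (w - (c - (γ : ℝ) * I))⁻¹)
        (-(stieltjesTransform (cauchyMeasure c γ) z) ^ 2) z := by
      refine (((hasDerivAt_id z).sub_const _).inv hne).congr_deriv ?_
      rw [stieltjesTransform_cauchyMeasure c γ hz]
      simp [neg_div]
    refine h1.congr_of_eventuallyEq ?_
    filter_upwards [isOpen_im_pos.mem_nhds hz] with w hw
    rw [stieltjesTransform_cauchyMeasure c γ hw, one_div]

lemma exists_cauchyMeasure_iff (μ : Measure ℝ) :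
    (∃ (c : ℝ) (γ : NNReal), μ = cauchyMeasure c γ) ↔
      (∃ c : ℝ, μ = Measure.dirac c) ∨
      (∃ (c : ℝ) (γ : NNReal), γ ≠ 0 ∧ μ = cauchyMeasure c γ) := by
  constructor
  · rintro ⟨c, γ, rfl⟩
    by_cases hγ : γ = 0
    · exact .inl ⟨c, by rw [hγ, cauchyMeasure_zero_scale]⟩
    · exact .inr ⟨c, γ, hγ, rfl⟩
  · rintro (⟨c, rfl⟩ | ⟨c, γ, -, rfl⟩)
    · exact ⟨c, 0, (cauchyMeasure_zero_scale c).symm⟩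
    · exact ⟨c, γ, rfl⟩

end

theorem theorem3p1 {Ω : Type*} [MeasurableSpace Ω] (P : Measure Ω) [IsProbabilityMeasure P]
    (n : ℕ) (hn : n = 1 ∨ n = 2) (μ : Measure ℝ) (X₁ X₂ Z : Ω → ℝ)
    (h : IsDirectedPower P n μ X₁ X₂ Z) :
    -- the Stieltjes equation `-S'(F_Z, z) = S(F_X, z) ^ 2`
    (∀ z : ℂ, (∀ x ∈ μ.support, (x : ℂ) ≠ z) → (∀ x ∈ (P.map Z).support, (x : ℂ) ≠ z) →
      HasDerivAt (stieltjesTransform (P.map Z)) (-(stieltjesTransform μ z) ^ 2) z) ∧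
    -- the laws for the exponents one and two coincide
    (∀ {Ω' : Type*} [MeasurableSpace Ω'] (P' : Measure Ω') [IsProbabilityMeasure P']
      (m : ℕ) (_ : m = 1 ∨ m = 2) (X₁' X₂' Z' : Ω' → ℝ),
      IsDirectedPower P' m μ X₁' X₂' Z' → P'.map Z' = P.map Z) ∧
    -- the arcsine characterization
    (pdf.IsUniform Z (Set.Icc (-1) 1) P volume ↔ μ = arcsineMeasure) ∧
    -- the Cauchy characterization
    (P.map Z = μ ↔
      (∃ c : ℝ, μ = Measure.dirac c) ∨
      (∃ (c : ℝ) (γ : NNReal), γ ≠ 0 ∧ μ = cauchyMeasure c γ)) := by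
  have := h.isProbabilityMeasure
  have hlaw := h.map_eq_segmentLaw hn
  refine ⟨fun z hμ hZ ↦ ?_, fun P' _ m hm X₁' X₂' Z' h' ↦ ?_, ?_, ?_⟩
  · rw [hlaw] at hZ ⊢
    exact hasDerivAt_stieltjesTransform_segmentLaw μ hμ hZ
  · rw [hlaw, h'.map_eq_segmentLaw hm]
  · rw [pdf.IsUniform, hlaw, segmentLaw_eq_uniform_iff]
  · rw [hlaw, segmentLaw_eq_self_iff, exists_cauchyMeasure_iff]
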